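/- Let $X$ be a nonseparable Banach space over $\mathbb{R}$. A *hyperplane* of $X$ is a closed linear subspace of codimension one. Let $\mathcal{H}_\sigma(X)$ be the family of all subsets of $X$ that can be covered by countably many hyperplanes, and let $\mathfrak{cov}(X)$ be the least cardinality of a family of sets from $\mathcal{H}_\sigma(X)$ whose union is $X$. Suppose that at least one of the following holds: 1. $X$ admits a fundamental biorthogonal system, i.e. there are $x_i\in X$ and $x_i^*\in X^*$ ($i\in I$) with $x_i^*(x_j)=\delta_{i,j}$ for all $i,j\in I$ and with the linear span of $\{x_i : i\in I\}$ dense in $X$; 2. $X$ is of the form $C(K)$, the space of real continuous functions with the supremum norm on a compact Hausdorff space $K$ that is scattered (every nonempty subset of $K$ has a relatively isolated point); 3. $X$ contains an isomorphic copy of $\ell_1(\omega_1)$, i.e. some linear subspace of $X$ is linearly homeomorphic to $\ell_1(\omega_1)$; 4. the closed dual unit ball $B_{X^*}$ with the weak$^*$ topology has uncountable tightness, i.e. there are $A\subseteq B_{X^*}$ and $x^*\in\overline{A}$ such that $x^*\notin\overline{B}$ for every countable $B\subseteq A$ (closures in the weak$^*$ topology). Then $X$ is the union of a family of exactly $\omega_1$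 hyperplanes, and $\mathfrak{cov}(X)=\omega_1$. -/

import Mathlib

open scoped Cardinal Ordinal

universe u v

/-- A hyperplane of a Banach space `X`: a closed linear subspace of codimension one. -/
def IsHyperplane {X : Type u} [NormedAddCommGroup X] [NormedSpace ℝ X]
    (H : Submodule ℝ X) : Prop :=
  IsClosed (H : Set X) ∧ Module.finrank ℝ (X ⧸ H) = 1

/-- The hyperplane ideal of `X`: the family of all subsets of `X` that can be covered by
countably many hyperplanes of `X`. -/
def hyperplaneIdeal (X : Type u) [NormedAddCommGroup X] [NormedSpace ℝ X] : Set (Set X) :=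
  {Y | ∃ F : Set (Submodule ℝ X), F.Countable ∧ (∀ H ∈ F, IsHyperplane H) ∧
    Y ⊆ ⋃ H ∈ F, (H : Set X)}

/-- `cov(X)`: the minimal cardinality of a family of sets from the hyperplane ideal whose union
is all of `X`. -/
noncomputable def covNumber (X : Type u) [NormedAddCommGroup X] [NormedSpace ℝ X] :
    Cardinal.{u} :=
  sInf {κ | ∃ A : Set (Set X), A ⊆ hyperplaneIdeal X ∧ ⋃₀ A = Set.univ ∧ #A = κ}

/-- `X` admits a fundamental biorthogonal system `(x i, φ i)`: `φ i (x j) = δ i j` and the linear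
span of the `x i` is dense in `X`. The index set may be any type; since `x` is injective, nothing
is lost by taking it in the universe of `X`. -/
def HasFundamentalBiorthogonalSystem (X : Type u) [NormedAddCommGroup X] [NormedSpace ℝ X] :
    Prop :=
  ∃ (I : Type u) (x : I → X) (φ : I → StrongDual ℝ X),
    (∀ i, φ i (x i) = 1) ∧ (∀ i j, i ≠ j → φ i (x j) = 0) ∧
      (Submodule.span ℝ (Set.range x)).topologicalClosure = ⊤

/-- A topological space is scattered if every nonempty subset has a relatively isolated point. -/
def IsScatteredSpace (K : Type v) [TopologicalSpace K] : Prop :=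
  ∀ A : Set K, A.Nonempty → ∃ x ∈ A, ∃ U : Set K, IsOpen U ∧ U ∩ A = {x}

/-- `X` is (isometrically) the space `C(K)` of real continuous functions, with the supremum norm,
on some scattered compact Hausdorff space `K`. -/
def IsSpaceOfContinuousOnScattered (X : Type u) [NormedAddCommGroup X] [NormedSpace ℝ X] :
    Prop :=
  ∃ (K : Type v) (_ : TopologicalSpace K) (_ : CompactSpace K) (_ : T2Space K),
    IsScatteredSpace K ∧ Nonempty (X ≃ₗᵢ[ℝ] C(K, ℝ))

/-- `X` contains an isomorphic copy of `ℓ₁(ω₁)`: some linear subspace of `X` is linearly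
homeomorphic to `ℓ₁(ω₁)`. -/
def ContainsEllOneOmegaOne (X : Type u) [NormedAddCommGroup X] [NormedSpace ℝ X] : Prop :=
  ∃ Y : Submodule ℝ X, Nonempty (lp (fun _ : (ω₁ : Ordinal.{0}).ToType => ℝ) 1 ≃L[ℝ] Y)

/-- Countable tightness: a point in the closure of a set `A` is in the closure of a countable
subset of `A`. -/
def IsCountablyTight (K : Type v) [TopologicalSpace K] : Prop :=
  ∀ (A : Set K) (x : K), x ∈ closure A → ∃ B : Set K, B ⊆ A ∧ B.Countable ∧ x ∈ closure B

/-- The closed unit ball of the dual of `X`, as a subset of the dual with the weak* topology. -/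
def weakStarDualBall (X : Type u) [NormedAddCommGroup X] [NormedSpace ℝ X] :
    Set (WeakDual ℝ X) :=
  {f | ‖WeakDual.toStrongDual f‖ ≤ 1}

/-! The kernels of `ω₁` nonzero functionals cover `X` as soon as every vector is annihilated by one
of them; by the Baire category theorem countably many sets of the hyperplane ideal never suffice.

A fundamental biorthogonal system gives such functionals because every vector of the closed span of
the `x i` has countable support. If `X` is mapped into the continuous functions on a compact space
`K` and separates points, differences of two evaluations can be used. For scattered `K` every
continuous function has countable range, so it identifies some pair among any `ω₁` points. Along an
`ω₁`-sequence converging to `p`, every continuous function is eventually equal to its value at `p`.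

Suppose that `K`, for instance the weak* dual ball, has uncountable tightness. Then `K` contains a
free sequence of length `ω₁`; let `P` be a closed set of points at which it accumulates only at
stage `ω₁`. Take a maximal state `m` on `C(P)` with a set of vectors of `X` at mutual
`L²(m)`-distance at least one. If this set is uncountable, the image of `X` in `L²(m)` is
nonseparable, and an orthonormal basis of its closure is a fundamental biorthogonal system. If it is
countable, then by maximality some `p ∈ P` has the property that each of its neighbourhoods contains
a joint fibre in `P` of these countably many vectors. This makes a suitable `ω₁`-sequence outside
`P` converge to `p`, in the manner of Juhász and Szentmiklóssy. Finally, `ℓ₁(ω₁) ⊆ X` forces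
uncountable tightness of the dual ball: by the Hahn–Banach theorem the indicators of all subsets of
`ω₁` extend, up to a common factor, to elements of the dual ball. -/

open Filter Topology Set

/-- The canonical well-ordered type of order type `ω₁`, the index type of transfinite sequences. -/
abbrev OmegaOne : Type := (ω₁ : Ordinal.{0}).ToType

section OmegaOne

theorem mk_omegaOne : #OmegaOne = ℵ₁ := by
  simp

instance : Uncountable OmegaOne :=
  Cardinal.aleph0_lt_mk_iff.1 (mk_omegaOne ▸ Cardinal.aleph0_lt_aleph_one)

instance : Nonempty OmegaOne :=
  not_isEmpty_iff.1 fun _ => not_countable (α := OmegaOne) inferInstance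

theorem countable_Iio_omegaOne (i : OmegaOne) : (Iio i).Countable := by
  rw [← Cardinal.le_aleph0_iff_set_countable, ← Cardinal.lt_aleph_one_iff, ← mk_omegaOne]
  exact Cardinal.mk_Iio_lt i (by simp)

theorem countable_Iic_omegaOne (i : OmegaOne) : (Iic i).Countable := by
  rw [← Iio_insert]
  exact (countable_Iio_omegaOne i).insert i

theorem exists_forall_lt_of_countable {s : Set OmegaOne} (hs : s.Countable) :
    ∃ i, ∀ j ∈ s, j < i := by
  by_contra! h
  refine not_countable (α := OmegaOne) (countable_univ_iff.1 ?_)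
  refine (hs.biUnion fun j _ => countable_Iic_omegaOne j).mono fun i _ => ?_
  obtain ⟨j, hj, hij⟩ := h i
  exact mem_biUnion hj hij

instance : NoMaxOrder OmegaOne where
  exists_gt i := (exists_forall_lt_of_countable (countable_singleton i)).imp fun _ h => h i rfl

instance : CountableInterFilter (atTop : Filter OmegaOne) where
  countable_sInter_mem S hS hmem := by
    choose! b hb using fun s (hs : s ∈ S) => mem_atTop_sets.1 (hmem s hs)
    obtain ⟨i, hi⟩ := exists_forall_lt_of_countable (hS.image b)
    exact mem_atTop_sets.2 ⟨i, fun j hij s hs =>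
      hb s hs j ((hi _ (mem_image_of_mem b hs)).le.trans hij)⟩

theorem nonempty_embedding_omegaOne (I : Type*) [Uncountable I] : Nonempty (OmegaOne ↪ I) := by
  rw [← Cardinal.lift_mk_le', mk_omegaOne]
  simp

theorem exists_omegaOne_seq {Y : Type*} {R : Set Y → Y → Prop}
    (h : ∀ C : Set Y, C.Countable → ∃ y, R C y) :
    ∃ f : OmegaOne → Y, ∀ i, R (f '' Iio i) (f i) := by
  choose y hy using fun C : {C : Set Y // C.Countable} => h C.1 C.2
  have hc (i : OmegaOne) (f : ∀ j < i, Y) : (range fun j : Iio i => f j j.2).Countable :=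
    have := (countable_Iio_omegaOne i).to_subtype
    countable_range _
  let F (i : OmegaOne) (f : ∀ j < i, Y) : Y := y ⟨range fun j : Iio i => f j j.2, hc i f⟩
  refine ⟨IsWellFounded.fix (· < ·) F, fun i => ?_⟩
  rw [image_eq_range, IsWellFounded.fix_eq (· < ·) F i]
  exact hy ⟨_, hc i fun j _ => IsWellFounded.fix (· < ·) F j⟩

end OmegaOne

theorem eventually_eq_of_tendsto {α β : Type*} {l : Filter α} [CountableInterFilter l]
    [TopologicalSpace β] [FirstCountableTopology β] [T1Space β] {f : α → β} {x : β}
    (hf : Tendsto f l (𝓝 x)) : ∀ᶠ a in l, f a = x := by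
  obtain ⟨U, hU⟩ := (𝓝 x).exists_antitone_basis
  filter_upwards [eventually_countable_forall.2 fun n => hf (hU.mem n)] with a ha
  by_contra hne
  obtain ⟨n, hn⟩ := hU.mem_iff.1 (isOpen_compl_singleton.mem_nhds (Ne.symm hne))
  exact hn (ha n) rfl

section Hyperplanes

variable {X : Type u} [NormedAddCommGroup X] [NormedSpace ℝ X]

theorem IsHyperplane.ne_top {H : Submodule ℝ X} (h : IsHyperplane H) : H ≠ ⊤ := by
  rintro rfl
  exact zero_ne_one (Module.finrank_zero_of_subsingleton.symm.trans h.2)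

theorem IsHyperplane.mem_hyperplaneIdeal {H : Submodule ℝ X} (h : IsHyperplane H) :
    (H : Set X) ∈ hyperplaneIdeal X :=
  ⟨{H}, countable_singleton H, by simpa using h, by simp⟩

theorem isHyperplane_ker {φ : StrongDual ℝ X} (h : φ ≠ 0) : IsHyperplane φ.ker := by
  refine ⟨φ.isClosed_ker, ?_⟩
  have hs : Function.Surjective (φ : X →ₗ[ℝ] ℝ) :=
    LinearMap.surjective fun h0 => h (ContinuousLinearMap.coe_injective h0)
  exact ((φ : X →ₗ[ℝ] ℝ).quotKerEquivOfSurjective hs).finrank_eq.trans (Module.finrank_self ℝ)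

theorem univ_notMem_hyperplaneIdeal [CompleteSpace X] : univ ∉ hyperplaneIdeal X := by
  rintro ⟨F, hF, hH, hU⟩
  have := hF.to_subtype
  rw [univ_subset_iff, biUnion_eq_iUnion] at hU
  obtain ⟨H, hi⟩ := nonempty_interior_of_iUnion_of_closed (fun H : F => (hH H.1 H.2).1) hU
  exact (hH H.1 H.2).ne_top (H.1.eq_top_of_nonempty_interior' hi)

theorem sUnion_mem_hyperplaneIdeal {A : Set (Set X)} (hA : A ⊆ hyperplaneIdeal X)
    (hc : A.Countable) : ⋃₀ A ∈ hyperplaneIdeal X := by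
  choose! F hF hH hU using fun a (ha : a ∈ A) => hA ha
  refine ⟨⋃ a ∈ A, F a, hc.biUnion hF, ?_, ?_⟩
  · simp only [mem_iUnion]
    rintro H ⟨a, ha, h⟩
    exact hH a ha H h
  · refine sUnion_subset fun a ha => (hU a ha).trans ?_
    exact biUnion_subset_biUnion_left (subset_biUnion_of_mem ha)

theorem aleph_one_le_mk_of_sUnion_eq_univ [CompleteSpace X] {A : Set (Set X)}
    (hA : A ⊆ hyperplaneIdeal X) (hU : ⋃₀ A = univ) : ℵ₁ ≤ #A := by
  rw [Cardinal.aleph_one_le_iff, ← not_le, Cardinal.le_aleph0_iff_set_countable]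
  exact fun hc => univ_notMem_hyperplaneIdeal (hU ▸ sUnion_mem_hyperplaneIdeal hA hc)

variable (X) in
/-- There are `ω₁` nonzero functionals such that every vector is annihilated by one of them.
Through kernels, this says that at most `ω₁` hyperplanes cover `X`. -/
def HasAnnihilatingFamily : Prop :=
  ∃ φ : OmegaOne → StrongDual ℝ X, (∀ i, φ i ≠ 0) ∧ ∀ x, ∃ i, φ i x = 0

namespace HasAnnihilatingFamily

theorem of_indexed {J : Type} (hJ : #J ≤ ℵ₁) (φ : J → StrongDual ℝ X) (h0 : ∀ j, φ j ≠ 0)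
    (h : ∀ x, ∃ j, φ j x = 0) : HasAnnihilatingFamily X := by
  have : Nonempty J := (h 0).nonempty
  rw [← mk_omegaOne] at hJ
  obtain ⟨e⟩ := hJ
  refine ⟨φ ∘ Function.invFun e, fun i => h0 _, fun x => ?_⟩
  obtain ⟨j, hj⟩ := h x
  exact ⟨e j, by rwa [Function.comp_apply, Function.leftInverse_invFun e.injective j]⟩

theorem of_denseRange {Y : Type*} [NormedAddCommGroup Y] [NormedSpace ℝ Y]
    (h : HasAnnihilatingFamily Y) (T : X →L[ℝ] Y) (hT : DenseRange T) :
    HasAnnihilatingFamily X := by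
  obtain ⟨φ, h0, h⟩ := h
  refine ⟨fun i => φ i ∘L T, fun i hi => h0 i ?_, fun x => h (T x)⟩
  exact DFunLike.coe_injective <|
    hT.equalizer (φ i).continuous continuous_zero (congrArg DFunLike.coe hi)

theorem exists_isHyperplane_cover [CompleteSpace X] (h : HasAnnihilatingFamily X) :
    ∃ F : Set (Submodule ℝ X), (∀ H ∈ F, IsHyperplane H) ∧ #F = ℵ₁ ∧
      ⋃ H ∈ F, (H : Set X) = univ := by
  obtain ⟨φ, h0, h⟩ := h
  have hU : ⋃ i, ((φ i).ker : Set X) = univ :=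
    eq_univ_of_forall fun x => mem_iUnion.2 (h x)
  refine ⟨range fun i => (φ i).ker, forall_mem_range.2 fun i => isHyperplane_ker (h0 i),
    le_antisymm ?_ ?_, by rwa [biUnion_range]⟩
  · simpa [mk_omegaOne] using Cardinal.mk_range_le_lift (f := fun i => (φ i).ker)
  · rw [← Cardinal.mk_image_eq SetLike.coe_injective, ← range_comp]
    exact aleph_one_le_mk_of_sUnion_eq_univ
      (range_subset_iff.2 fun i => (isHyperplane_ker (h0 i)).mem_hyperplaneIdeal)
      (by rwa [sUnion_range])

theorem covNumber_eq [CompleteSpace X] (h : HasAnnihilatingFamily X) : covNumber X = ℵ₁ := by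
  obtain ⟨F, hF, hFcard, hU⟩ := h.exists_isHyperplane_cover
  refine IsLeast.csInf_eq ⟨⟨SetLike.coe '' F, ?_, ?_, ?_⟩, ?_⟩
  · exact image_subset_iff.2 fun H hH => (hF H hH).mem_hyperplaneIdeal
  · rwa [sUnion_image]
  · rw [Cardinal.mk_image_eq SetLike.coe_injective, hFcard]
  · rintro _ ⟨A, hA, hAU, rfl⟩
    exact aleph_one_le_mk_of_sUnion_eq_univ hA hAU

end HasAnnihilatingFamily

end Hyperplanes

section CountableSupport

variable {X : Type u} [NormedAddCommGroup X] [NormedSpace ℝ X] {I : Type*}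

/-- The vectors on which all but countably many of the functionals `φ i` vanish. -/
def countableSupport (φ : I → StrongDual ℝ X) : Submodule ℝ X where
  carrier := {x | {i | φ i x ≠ 0}.Countable}
  zero_mem' := by simp
  add_mem' {x y} hx hy := (hx.union hy).mono fun i hi => by
    simp only [mem_union, mem_ofPred_eq]
    contrapose! hi
    simp [hi]
  smul_mem' c x hx := hx.mono fun i hi => by
    simp only [mem_ofPred_eq, map_smul, smul_eq_mul] at hi
    exact right_ne_zero_of_mul hi

theorem isClosed_countableSupport (φ : I → StrongDual ℝ X) :
    IsClosed (countableSupport φ : Set X) := by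
  refine IsSeqClosed.isClosed fun s x hs hx => ?_
  refine (countable_iUnion hs).mono fun i hi => ?_
  rw [mem_iUnion]
  contrapose! hi
  have h0 : (fun n => φ i (s n)) = 0 := funext fun n => not_not.1 (hi n)
  have hφ : Tendsto (fun n => φ i (s n)) atTop (𝓝 (φ i x)) := ((φ i).continuous.tendsto x).comp hx
  rw [h0] at hφ
  exact not_not.2 (tendsto_nhds_unique hφ tendsto_const_nhds)

namespace HasAnnihilatingFamily

theorem of_countableSupport_eq_top [Uncountable I] (φ : I → StrongDual ℝ X) (h0 : ∀ i, φ i ≠ 0)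
    (h : countableSupport φ = ⊤) : HasAnnihilatingFamily X := by
  obtain ⟨e⟩ := nonempty_embedding_omegaOne I
  refine ⟨φ ∘ e, fun i => h0 _, fun x => ?_⟩
  have hx : x ∈ countableSupport φ := h ▸ Submodule.mem_top
  have hc : {i | φ (e i) x ≠ 0}.Countable := Countable.preimage hx e.injective
  by_contra! hne
  exact not_countable (α := OmegaOne) (countable_univ_iff.1 (hc.mono fun i _ => hne i))

theorem of_hasFundamentalBiorthogonalSystem (hX : ¬ TopologicalSpace.SeparableSpace X)
    (h : HasFundamentalBiorthogonalSystem X) : HasAnnihilatingFamily X := by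
  obtain ⟨I, x, φ, h1, h0, hd⟩ := h
  have : Uncountable I := by
    refine not_countable_iff.1 fun hI => hX ?_
    rw [← TopologicalSpace.isSeparable_univ_iff, ← Submodule.top_coe (R := ℝ), ← hd,
      Submodule.topologicalClosure_coe]
    exact (countable_range x).isSeparable.span.closure
  have hx : range x ⊆ countableSupport φ := range_subset_iff.2 fun j =>
    (countable_singleton j).mono fun i hi => of_not_not fun hij => hi (h0 i j hij)
  refine of_countableSupport_eq_top φ (fun i h => by simpa [h] using h1 i) (top_unique ?_)
  rw [← hd]
  exact Submodule.topologicalClosure_minimal _ (Submodule.span_le.2 hx)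
    (isClosed_countableSupport φ)

end HasAnnihilatingFamily

theorem hasFundamentalBiorthogonalSystem_of_innerProductSpace (H : Type u) [NormedAddCommGroup H]
    [InnerProductSpace ℝ H] [CompleteSpace H] : HasFundamentalBiorthogonalSystem H := by
  obtain ⟨w, b, -⟩ := exists_hilbertBasis ℝ H
  exact ⟨w, b, fun i => innerSL ℝ (b i), fun i => by simp [b.orthonormal.norm_eq_one i],
    fun i j hij => b.orthonormal.inner_eq_zero hij, b.dense_span⟩

theorem HasAnnihilatingFamily.of_not_isSeparable_range {H : Type*} [NormedAddCommGroup H]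
    [InnerProductSpace ℝ H] [CompleteSpace H] (T : X →L[ℝ] H)
    (hT : ¬ TopologicalSpace.IsSeparable (range T)) : HasAnnihilatingFamily X := by
  let Y : Submodule ℝ H := T.range.topologicalClosure
  let S : X →L[ℝ] Y := T.codRestrict Y fun x => subset_closure (mem_range_self x)
  have hS : DenseRange S := by
    have hS : DenseRange (inclusion (subset_closure (s := range T))) :=
      (denseRange_inclusion_iff _).2 subset_rfl
    exact hS.comp rangeFactorization_surjective.denseRange (continuous_inclusion _)
  have hY : ¬ TopologicalSpace.SeparableSpace Y := fun hY => hT <|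
    (TopologicalSpace.IsSeparable.of_subtype (Y : Set H)).mono subset_closure
  exact (of_hasFundamentalBiorthogonalSystem hY
    (hasFundamentalBiorthogonalSystem_of_innerProductSpace Y)).of_denseRange S hS

end CountableSupport

namespace HasAnnihilatingFamily

variable {X : Type u} [NormedAddCommGroup X] [NormedSpace ℝ X]
  {K : Type v} [TopologicalSpace K] {Θ : X →L[ℝ] C(K, ℝ)}

theorem of_pairs (hΘ : Function.Injective fun (p : K) (x : X) => Θ x p) {J : Type}
    (hJ : #J ≤ ℵ₁) (p q : J → K) (hpq : ∀ j, p j ≠ q j) (h : ∀ x, ∃ j, Θ x (p j) = Θ x (q j)) :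
    HasAnnihilatingFamily X := by
  refine of_indexed hJ
    (fun j => (ContinuousMap.evalCLM ℝ (p j) - ContinuousMap.evalCLM ℝ (q j)) ∘L Θ)
    (fun j hj => hpq j (hΘ (funext fun x => ?_))) fun x => (h x).imp fun j hj => sub_eq_zero.2 hj
  have hx : Θ x (p j) - Θ x (q j) = 0 := DFunLike.congr_fun hj x
  exact sub_eq_zero.1 hx

theorem of_tendsto (hΘ : Function.Injective fun (p : K) (x : X) => Θ x p) {a : OmegaOne → K}
    {p : K} (ha : Tendsto a atTop (𝓝 p)) (hne : ∀ i, a i ≠ p) : HasAnnihilatingFamily X :=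
  of_pairs hΘ mk_omegaOne.le a (fun _ => p) hne fun x =>
    (eventually_eq_of_tendsto (((Θ x).continuous.tendsto p).comp ha)).exists

theorem of_countable_range [Uncountable K] (hΘ : Function.Injective fun (p : K) (x : X) => Θ x p)
    (h : ∀ x, (range (Θ x)).Countable) : HasAnnihilatingFamily X := by
  obtain ⟨e⟩ := nonempty_embedding_omegaOne K
  have hJ : #{ij : OmegaOne × OmegaOne // ij.1 ≠ ij.2} ≤ ℵ₁ := by
    refine (Cardinal.mk_subtype_le _).trans ?_
    rw [Cardinal.mk_prod, Cardinal.lift_id, mk_omegaOne,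
      Cardinal.mul_eq_self (Cardinal.aleph0_le_aleph 1)]
  refine of_pairs hΘ hJ (fun ij => e ij.1.1) (fun ij => e ij.1.2)
    (fun ij => e.injective.ne ij.2) fun x => ?_
  have := (h x).to_subtype
  have hninj : ¬ Function.Injective (rangeFactorization (Θ x) ∘ e) := fun hinj =>
    not_countable hinj.countable
  obtain ⟨i, j, heq, hij⟩ := Function.not_injective_iff.1 hninj
  exact ⟨⟨(i, j), hij⟩, congrArg Subtype.val heq⟩

end HasAnnihilatingFamily

section Scattered

variable {K : Type v} [TopologicalSpace K] {Y : Type*}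

theorem countable_image_of_isCompact {f : K → Y} {s : Set K} (hs : IsCompact s)
    (h : ∀ x ∈ s, ∃ U ∈ 𝓝 x, (f '' U).Countable) : (f '' s).Countable :=
  hs.induction_on (p := fun t => (f '' t).Countable) (by simp)
    (fun _ _ hst ht => ht.mono (image_mono hst))
    (fun s t hs ht => by simpa only [image_union] using hs.union ht)
    fun x hx => (h x hx).imp fun U hU => ⟨mem_nhdsWithin_of_mem_nhds hU.1, hU.2⟩

theorem IsScatteredSpace.countable_range [CompactSpace K] [T2Space K] (hK : IsScatteredSpace K)
    [TopologicalSpace Y] [FirstCountableTopology Y] [T1Space Y] {f : K → Y} (hf : Continuous f) :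
    (range f).Countable := by
  let A : Set K := {x | ∀ U ∈ 𝓝 x, ¬ (f '' U).Countable}
  suffices hA : ¬ A.Nonempty by
    rw [← image_univ]
    refine countable_image_of_isCompact isCompact_univ fun x _ => ?_
    by_contra! hx
    exact hA ⟨x, hx⟩
  intro hA
  obtain ⟨x, hxA, U, hU, hUx⟩ := hK A hA
  have hxU : x ∈ U := (hUx.symm ▸ mem_singleton x : x ∈ U ∩ A).1
  obtain ⟨V, hV, hVU, hVc⟩ := local_compact_nhds (hU.mem_nhds hxU)
  obtain ⟨W, hWo, hW⟩ := (IsGδ.singleton (f x)).eq_iInter_nat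
  have hVW (n : ℕ) : (f '' (V ∩ f ⁻¹' (W n)ᶜ)).Countable := by
    refine countable_image_of_isCompact
      (hVc.inter_right ((hWo n).isClosed_compl.preimage hf)) fun y hy => ?_
    by_contra! hyA
    have hyx : y = x := (hUx ▸ (⟨hVU hy.1, hyA⟩ : y ∈ U ∩ A) : y ∈ ({x} : Set K))
    exact hy.2 (hyx ▸ mem_iInter.1 (hW ▸ mem_singleton (f x)) n)
  refine hxA V hV (((countable_iUnion hVW).insert (f x)).mono ?_)
  rintro _ ⟨y, hy, rfl⟩
  by_cases hyx : f y = f x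
  · exact .inl hyx
  · rw [← mem_singleton_iff, hW, mem_iInter, not_forall] at hyx
    obtain ⟨n, hn⟩ := hyx
    exact .inr (mem_iUnion.2 ⟨n, y, ⟨hy, hn⟩, rfl⟩)

variable [CompactSpace K] [T2Space K]

theorem metrizableSpace_of_countable_compact [Countable K] :
    TopologicalSpace.MetrizableSpace K := by
  let J := {pq : K × K // pq.1 ≠ pq.2}
  have : Encodable J := Encodable.ofCountable J
  choose f hf hne using fun pq : J => separatesPoints_continuous_of_t35Space pq.2
  exact Metric.PiNatEmbed.TopologicalSpace.MetrizableSpace.of_countable_separating f hf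
    fun p q hpq => ⟨⟨(p, q), hpq⟩, hne _⟩

theorem HasAnnihilatingFamily.of_continuousLinearEquiv_continuousMap {X : Type u}
    [NormedAddCommGroup X] [NormedSpace ℝ X] (hX : ¬ TopologicalSpace.SeparableSpace X)
    (hK : IsScatteredSpace K) (T : X ≃L[ℝ] C(K, ℝ)) : HasAnnihilatingFamily X := by
  have : Uncountable K := by
    refine not_countable_iff.1 fun _ => hX ?_
    have := metrizableSpace_of_countable_compact (K := K)
    exact T.symm.surjective.denseRange.separableSpace T.symm.continuous
  refine of_countable_range (Θ := (T : X →L[ℝ] C(K, ℝ))) (fun p q hpq => ?_)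
    fun x => hK.countable_range (T x).continuous
  by_contra hne
  obtain ⟨f, hf, hfne⟩ := separatesPoints_continuous_of_t35Space hne
  exact hfne (by simpa using congrFun hpq (T.symm ⟨f, hf⟩))

theorem HasAnnihilatingFamily.of_isSpaceOfContinuousOnScattered {X : Type u}
    [NormedAddCommGroup X] [NormedSpace ℝ X] (hX : ¬ TopologicalSpace.SeparableSpace X)
    (h : IsSpaceOfContinuousOnScattered.{u, v} X) : HasAnnihilatingFamily X := by
  obtain ⟨K, _, _, _, hK, ⟨T⟩⟩ := h
  exact of_continuousLinearEquiv_continuousMap hX hK T.toContinuousLinearEquiv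

end Scattered

theorem exists_linearMap_eq_of_sublinear {V : Type*} [AddCommGroup V] [Module ℝ V] {N : V → ℝ}
    (N_smul : ∀ c : ℝ, 0 < c → ∀ x, N (c • x) = c * N x) (N_add : ∀ x y, N (x + y) ≤ N x + N y)
    (x : V) : ∃ g : V →ₗ[ℝ] ℝ, g x = N x ∧ ∀ y, g y ≤ N y := by
  have N_zero : N 0 = 0 := by
    have := N_smul 2 two_pos 0
    rw [smul_zero] at this
    linarith
  have hx (c : ℝ) (hc : c • x = 0) : c • N x = 0 := by
    rcases smul_eq_zero.1 hc with rfl | rfl <;> simp [N_zero]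
  have hle (c : ℝ) : c * N x ≤ N (c • x) := by
    rcases lt_trichotomy c 0 with hc | rfl | hc
    · have := N_add (c • x) (-c • x)
      rw [N_smul (-c) (neg_pos.2 hc), ← add_smul, add_neg_cancel, zero_smul, N_zero] at this
      linarith
    · simp [N_zero]
    · exact (N_smul c hc x).ge
  obtain ⟨g, hg, hgN⟩ := exists_extension_of_le_sublinear
    (LinearPMap.mkSpanSingleton' x (N x) hx) N N_smul N_add (by
      rintro ⟨y, hy⟩
      obtain ⟨c, rfl⟩ := Submodule.mem_span_singleton.1 hy
      rw [LinearPMap.mkSpanSingleton'_apply]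
      exact hle c)
  refine ⟨g, ?_, hgN⟩
  exact (hg ⟨x, Submodule.mem_span_singleton_self x⟩).trans
    (LinearPMap.mkSpanSingleton'_apply_self x (N x) hx _)

theorem exists_hilbert_of_preInner {V : Type u} [AddCommGroup V] [Module ℝ V]
    (c : PreInnerProductSpace.Core ℝ V) :
    ∃ (H : Type u) (_ : NormedAddCommGroup H) (_ : InnerProductSpace ℝ H) (_ : CompleteSpace H)
      (T : V →ₗ[ℝ] H), ∀ x y, inner ℝ (T x) (T y) = c.inner x y := by
  let _ : SeminormedAddCommGroup V :=
    InnerProductSpace.Core.toSeminormedAddCommGroup (𝕜 := ℝ) (c := c)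
  let _ : InnerProductSpace ℝ V := InnerProductSpace.ofCore c
  exact ⟨UniformSpace.Completion V, inferInstance, inferInstance, inferInstance,
    (UniformSpace.Completion.toComplₗᵢ : V →ₗᵢ[ℝ] UniformSpace.Completion V).toLinearMap,
    UniformSpace.Completion.inner_coe⟩

/-- A normalized positive linear functional on `C(P, ℝ)`; for compact `P` these correspond to the
regular Borel probability measures on `P`. -/
structure IsState {P : Type*} [TopologicalSpace P] (m : C(P, ℝ) →ₗ[ℝ] ℝ) : Prop where
  nonneg : ∀ f, 0 ≤ f → 0 ≤ m f
  map_one : m 1 = 1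

/-- The least value at `f` allowed by upper bounds from `C`: `inf {m h | h ∈ C, f ≤ h}`. For a state
`m`, it is the largest value at `f` of a state agreeing with `m` on `C`. -/
noncomputable def upperEnvelope {P : Type*} [TopologicalSpace P] (m : C(P, ℝ) →ₗ[ℝ] ℝ)
    (C : Submodule ℝ C(P, ℝ)) (f : C(P, ℝ)) : ℝ :=
  sInf (m '' {h | h ∈ C ∧ f ≤ h})

theorem le_upperEnvelope {P : Type*} [TopologicalSpace P] [CompactSpace P]
    {m : C(P, ℝ) →ₗ[ℝ] ℝ} {C : Submodule ℝ C(P, ℝ)} {f : C(P, ℝ)} {t : ℝ} (h1 : 1 ∈ C)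
    (ht : ∀ h ∈ C, f ≤ h → t ≤ m h) : t ≤ upperEnvelope m C f :=
  le_csInf ⟨_, ‖f‖ • 1, ⟨C.smul_mem _ h1, fun p => by simpa using f.apply_le_norm p⟩, rfl⟩
    (forall_mem_image.2 fun h hh => ht h hh.1 hh.2)

namespace IsState

variable {P : Type*} [TopologicalSpace P] {m m₀ m₁ : C(P, ℝ) →ₗ[ℝ] ℝ}

theorem eval (p : P) : IsState (ContinuousMap.evalCLM ℝ p : C(P, ℝ) →L[ℝ] ℝ).toLinearMap where
  nonneg _ hf := hf p
  map_one := rfl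

theorem mono (hm : IsState m) {f g : C(P, ℝ)} (h : f ≤ g) : m f ≤ m g := by
  have := hm.nonneg (g - f) (sub_nonneg.2 h)
  rwa [map_sub, sub_nonneg] at this

theorem sq_le (hm : IsState m) (f : C(P, ℝ)) : m f ^ 2 ≤ m (f ^ 2) := by
  have h : 0 ≤ m ((f - m f • 1) ^ 2) := hm.nonneg _ fun p => sq_nonneg ((f - m f • 1) p)
  have e : (f - m f • 1) ^ 2 = f ^ 2 - (2 * m f) • f + (m f ^ 2) • 1 := by
    ext p
    simp
    ring
  simp only [e, map_add, map_sub, map_smul, hm.map_one, smul_eq_mul] at h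
  linarith

theorem average (h₀ : IsState m₀) (h₁ : IsState m₁) : IsState ((1 / 2 : ℝ) • (m₀ + m₁)) where
  nonneg f hf := mul_nonneg (by norm_num) (add_nonneg (h₀.nonneg f hf) (h₁.nonneg f hf))
  map_one := by
    rw [LinearMap.smul_apply, LinearMap.add_apply, h₀.map_one, h₁.map_one]
    norm_num

variable {C : Submodule ℝ C(P, ℝ)} {f g h : C(P, ℝ)}

theorem upperEnvelope_le (hm : IsState m) (hh : h ∈ C) (hfh : f ≤ h) :
    upperEnvelope m C f ≤ m h :=
  csInf_le ⟨m f, forall_mem_image.2 fun _ hg => hm.mono hg.2⟩ (mem_image_of_mem m ⟨hh, hfh⟩)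

variable [CompactSpace P]

theorem abs_le_norm (hm : IsState m) (f : C(P, ℝ)) : |m f| ≤ ‖f‖ := by
  have h (g : C(P, ℝ)) : m g ≤ ‖g‖ := by
    have := hm.mono (f := g) (g := ‖g‖ • 1) fun p => by simpa using g.apply_le_norm p
    rwa [map_smul, hm.map_one, smul_eq_mul, mul_one] at this
  refine abs_le'.2 ⟨h f, ?_⟩
  rw [← map_neg, ← norm_neg]
  exact h (-f)

theorem exists_tendsto {I : Type*} (𝓥 : Ultrafilter I) {M : I → C(P, ℝ) →ₗ[ℝ] ℝ}
    (hM : ∀ i, IsState (M i)) :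
    ∃ m : C(P, ℝ) →ₗ[ℝ] ℝ, IsState m ∧ ∀ f, Tendsto (fun i => M i f) 𝓥 (𝓝 (m f)) := by
  have hbdd : ∀ i, (fun f => M i f) ∈ univ.pi fun f : C(P, ℝ) => Icc (-‖f‖) ‖f‖ :=
    fun i f _ => abs_le.1 ((hM i).abs_le_norm f)
  obtain ⟨L, -, hL⟩ := (isCompact_univ_pi fun f : C(P, ℝ) => isCompact_Icc).ultrafilter_le_nhds
    (𝓥.map fun i f => M i f) (tendsto_principal.2 (.of_forall hbdd))
  have hL' := tendsto_pi_nhds.1 hL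
  refine ⟨linearMapOfTendsto L M hL, ⟨fun f hf => ?_, ?_⟩, hL'⟩
  · exact ge_of_tendsto (hL' f) (Eventually.of_forall fun i => (hM i).nonneg f hf)
  · exact tendsto_nhds_unique (hL' 1) (tendsto_const_nhds.congr fun i => ((hM i).map_one).symm)

/-- The Gelfand–Naimark–Segal construction: `H` is the space `L²(m)`. -/
theorem exists_hilbert {P : Type u} [TopologicalSpace P] [CompactSpace P] {m : C(P, ℝ) →ₗ[ℝ] ℝ}
    (hm : IsState m) :
    ∃ (H : Type u) (_ : NormedAddCommGroup H) (_ : InnerProductSpace ℝ H) (_ : CompleteSpace H)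
      (T : C(P, ℝ) →L[ℝ] H), ∀ f g, inner ℝ (T f) (T g) = m (f * g) := by
  let c : PreInnerProductSpace.Core ℝ C(P, ℝ) :=
    { inner := fun f g => m (f * g)
      conj_inner_symm := fun f g => congrArg m (mul_comm g f)
      re_inner_nonneg := fun f => hm.nonneg _ fun p => mul_self_nonneg (f p)
      add_left := fun f g h => by simp [add_mul]
      smul_left := fun f g r => by simp }
  obtain ⟨H, _, _, _, T, hT⟩ := exists_hilbert_of_preInner c
  refine ⟨H, inferInstance, inferInstance, inferInstance, T.mkContinuous 1 fun f => ?_, hT⟩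
  rw [one_mul]
  refine le_of_sq_le_sq ?_ (norm_nonneg f)
  rw [← real_inner_self_eq_norm_sq, hT, sq]
  exact (le_abs_self _).trans ((hm.abs_le_norm _).trans (norm_mul_le f f))

theorem upperEnvelope_smul_le (hm : IsState m) (h1 : 1 ∈ C) {c : ℝ} (hc : 0 < c) :
    upperEnvelope m C (c • f) ≤ c * upperEnvelope m C f := by
  rw [← div_le_iff₀' hc]
  refine le_upperEnvelope h1 fun h hh hfh => ?_
  rw [div_le_iff₀' hc, ← smul_eq_mul, ← map_smul]
  exact hm.upperEnvelope_le (C.smul_mem c hh) (smul_le_smul_of_nonneg_left hfh hc.le)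

theorem upperEnvelope_smul (hm : IsState m) (h1 : 1 ∈ C) {c : ℝ} (hc : 0 < c) :
    upperEnvelope m C (c • f) = c * upperEnvelope m C f := by
  refine le_antisymm (hm.upperEnvelope_smul_le h1 hc) ?_
  have := hm.upperEnvelope_smul_le h1 (f := c • f) (inv_pos.2 hc)
  rwa [inv_smul_smul₀ hc.ne', le_inv_mul_iff₀ hc] at this

theorem upperEnvelope_add_le (hm : IsState m) (h1 : 1 ∈ C) :
    upperEnvelope m C (f + g) ≤ upperEnvelope m C f + upperEnvelope m C g := by
  rw [← sub_le_iff_le_add]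
  refine le_upperEnvelope h1 fun h hh hfh => ?_
  rw [sub_le_comm]
  refine le_upperEnvelope h1 fun k hk hgk => ?_
  rw [sub_le_iff_le_add', ← map_add]
  exact hm.upperEnvelope_le (C.add_mem hh hk) (add_le_add hfh hgk)

theorem exists_eq_upperEnvelope (hm : IsState m) (h1 : 1 ∈ C) (f : C(P, ℝ)) :
    ∃ m', IsState m' ∧ (∀ h ∈ C, m' h = m h) ∧ m' f = upperEnvelope m C f := by
  obtain ⟨m', hf, hle⟩ := exists_linearMap_eq_of_sublinear (N := upperEnvelope m C)
    (fun _ hc _ => hm.upperEnvelope_smul h1 hc) (fun _ _ => hm.upperEnvelope_add_le h1) f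
  have hC (h) (hh : h ∈ C) : m' h ≤ m h := (hle h).trans (hm.upperEnvelope_le hh le_rfl)
  have hC' (h) (hh : h ∈ C) : m' h = m h := by
    have := hC (-h) (C.neg_mem hh)
    rw [map_neg, map_neg, neg_le_neg_iff] at this
    exact (hC h hh).antisymm this
  refine ⟨m', ⟨fun g hg => ?_, (hC' 1 h1).trans hm.map_one⟩, hC', hf⟩
  have := (hle (-g)).trans (hm.upperEnvelope_le C.zero_mem (neg_nonpos.2 hg))
  rwa [map_neg, map_zero, neg_nonpos] at this

/-- Averaging two extreme extensions puts `f` at `L²`-distance from `C` at least half the gap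
between the upper and lower envelopes of `f`. -/
theorem exists_sq_le_apply_sub_sq (hm : IsState m) (h1 : 1 ∈ C) (f : C(P, ℝ)) :
    ∃ m', IsState m' ∧ (∀ h ∈ C, m' h = m h) ∧
      ∀ h ∈ C, ((upperEnvelope m C f + upperEnvelope m C (-f)) / 2) ^ 2 ≤ m' ((f - h) ^ 2) := by
  obtain ⟨m₁, hm₁, hC₁, hf₁⟩ := hm.exists_eq_upperEnvelope h1 f
  obtain ⟨m₀, hm₀, hC₀, hf₀⟩ := hm.exists_eq_upperEnvelope h1 (-f)
  refine ⟨_, hm₀.average hm₁, fun h hh => ?_, fun h hh => ?_⟩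
  · simp only [LinearMap.smul_apply, LinearMap.add_apply, smul_eq_mul, hC₀ h hh, hC₁ h hh]
    ring
  · have h₀ := hm₀.sq_le (f - h)
    have h₁ := hm₁.sq_le (f - h)
    rw [map_neg] at hf₀
    rw [map_sub, hC₀ h hh] at h₀
    rw [map_sub, hC₁ h hh] at h₁
    simp only [LinearMap.smul_apply, LinearMap.add_apply, smul_eq_mul]
    rw [← hf₁, ← hf₀]
    nlinarith [sq_nonneg ((m₁ f - m h) + (m₀ f - m h))]

end IsState

/-- The fibre through `q` of the map `P → (E → ℝ)` with coordinates `Θ x`, `x ∈ E`. -/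
def jointFiber {ι P : Type*} [TopologicalSpace P] (Θ : ι → C(P, ℝ)) (E : Set ι) (q : P) : Set P :=
  {r | ∀ x ∈ E, Θ x r = Θ x q}

/-- The continuous functions on `P` which are constant on the joint fibres of the functions `Θ x`,
`x ∈ E`. -/
def fiberSubalgebra {ι P : Type*} [TopologicalSpace P] (Θ : ι → C(P, ℝ)) (E : Set ι) :
    Subalgebra ℝ C(P, ℝ) where
  carrier := {h | ∀ q, ∀ r ∈ jointFiber Θ E q, h r = h q}
  mul_mem' ha hb q r hr := congrArg₂ (· * ·) (ha q r hr) (hb q r hr)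
  add_mem' ha hb q r hr := congrArg₂ (· + ·) (ha q r hr) (hb q r hr)
  algebraMap_mem' _ _ _ _ := rfl

section FiberSubalgebra

variable {ι P : Type*} [TopologicalSpace P] {Θ : ι → C(P, ℝ)} {E E' : Set ι}

theorem fiberSubalgebra_mono (h : E ⊆ E') : fiberSubalgebra Θ E ≤ fiberSubalgebra Θ E' :=
  fun _ hf q r hr => hf q r fun x hx => hr x (h hx)

theorem apply_mem_fiberSubalgebra {x : ι} (hx : x ∈ E) : Θ x ∈ fiberSubalgebra Θ E :=
  fun _ _ hr => hr x hx

theorem sub_sq_mem_fiberSubalgebra {x y : ι} (hx : x ∈ E) (hy : y ∈ E) :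
    (Θ x - Θ y) ^ 2 ∈ fiberSubalgebra Θ E :=
  pow_mem (sub_mem (apply_mem_fiberSubalgebra hx) (apply_mem_fiberSubalgebra hy)) 2

end FiberSubalgebra

/-- A state together with a set of indices `x` for which the functions `Θ x` have mutual
`L²`-distance at least one. -/
structure SeparatedState {ι P : Type*} [TopologicalSpace P] (Θ : ι → C(P, ℝ)) where
  carrier : Set ι
  state : C(P, ℝ) →ₗ[ℝ] ℝ
  isState : IsState state
  one_le : ∀ x ∈ carrier, ∀ y ∈ carrier, x ≠ y → 1 ≤ state ((Θ x - Θ y) ^ 2)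

namespace SeparatedState

section Order

variable {ι P : Type*} [TopologicalSpace P] {Θ : ι → C(P, ℝ)}

/-- The continuous functions determined by the functions `Θ x` with `x` in the carrier. -/
def functions (s : SeparatedState Θ) : Submodule ℝ C(P, ℝ) :=
  (fiberSubalgebra Θ s.carrier).toSubmodule

theorem one_mem_functions (s : SeparatedState Θ) : 1 ∈ s.functions :=
  one_mem (fiberSubalgebra Θ s.carrier)

instance : Preorder (SeparatedState Θ) where
  le s t := s.carrier ⊆ t.carrier ∧ ∀ h ∈ s.functions, t.state h = s.state h
  le_refl _ := ⟨Subset.rfl, fun _ _ => rfl⟩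
  le_trans _ _ _ hst htr := ⟨hst.1.trans htr.1, fun h hh =>
    (htr.2 h (fiberSubalgebra_mono hst.1 hh)).trans (hst.2 h hh)⟩

variable [CompactSpace P]

theorem exists_le_of_isChain {c : Set (SeparatedState Θ)} (hc : IsChain (· ≤ ·) c)
    (hne : c.Nonempty) : ∃ t, ∀ s ∈ c, s ≤ t := by
  have : Nonempty c := hne.to_subtype
  have : IsDirectedOrder c := directedOn_iff_isDirectedOrder.1 hc.directedOn
  let 𝓥 : Ultrafilter c := Ultrafilter.of atTop
  obtain ⟨m, hm, hlim⟩ :=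
    IsState.exists_tendsto 𝓥 (M := fun s : c => s.1.state) fun s => s.1.isState
  have hmc (s : c) : ∀ h ∈ s.1.functions, m h = s.1.state h := fun h hh => by
    refine tendsto_nhds_unique (hlim h) (tendsto_const_nhds.congr' ?_)
    filter_upwards [Ultrafilter.of_le atTop (eventually_ge_atTop s)] with t hst
    exact (hst.2 h hh).symm
  refine ⟨⟨⋃ s : c, s.1.carrier, m, hm, fun x hx y hy hxy => ?_⟩, fun s hs =>
    ⟨subset_iUnion (fun s : c => s.1.carrier) ⟨s, hs⟩, hmc ⟨s, hs⟩⟩⟩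
  obtain ⟨s, hs⟩ := mem_iUnion.1 hx
  obtain ⟨t, ht⟩ := mem_iUnion.1 hy
  obtain ⟨r, hsr, htr⟩ := exists_ge_ge s t
  rw [hmc r _ (sub_sq_mem_fiberSubalgebra (hsr.1 hs) (htr.1 ht))]
  exact r.1.one_le x (hsr.1 hs) y (htr.1 ht) hxy

variable (Θ) in
theorem exists_isMax [Nonempty P] : ∃ s : SeparatedState Θ, IsMax s := by
  refine zorn_le fun c hc => ?_
  rcases c.eq_empty_or_nonempty with rfl | hne
  · exact ⟨⟨∅, _, .eval (Classical.arbitrary P), by simp⟩, by simp [upperBounds]⟩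
  · exact exists_le_of_isChain hc hne

/-- Otherwise `x` could be added to the carrier, for an extension of the state. -/
theorem mem_carrier_of_two_le {s : SeparatedState Θ} (hs : IsMax s) {x : ι}
    (hx : 2 ≤ upperEnvelope s.state s.functions (Θ x) +
      upperEnvelope s.state s.functions (-Θ x)) : x ∈ s.carrier := by
  obtain ⟨m, hm, hms, hdist⟩ := s.isState.exists_sq_le_apply_sub_sq s.one_mem_functions (Θ x)
  have hx' : ∀ y ∈ s.carrier, 1 ≤ m ((Θ x - Θ y) ^ 2) := fun y hy =>
    le_trans (by nlinarith) (hdist _ (apply_mem_fiberSubalgebra hy))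
  let t : SeparatedState Θ :=
    { carrier := insert x s.carrier
      state := m
      isState := hm
      one_le := by
        rintro y (rfl | hy) z (rfl | hz) hyz
        · exact absurd rfl hyz
        · exact hx' z hz
        · rw [← neg_sub, neg_sq]
          exact hx' y hy
        · rw [hms _ (sub_sq_mem_fiberSubalgebra hy hz)]
          exact s.one_le y hy z hz hyz }
  have hst : s ≤ t := ⟨subset_insert _ _, hms⟩
  exact (hs hst).1 (mem_insert _ _)

theorem upperEnvelope_add_upperEnvelope_neg_lt_two {s : SeparatedState Θ} (hs : IsMax s) (x : ι) :
    upperEnvelope s.state s.functions (Θ x) + upperEnvelope s.state s.functions (-Θ x) < 2 := by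
  by_contra! hx
  have hΘx : Θ x ∈ s.functions := apply_mem_fiberSubalgebra (mem_carrier_of_two_le hs hx)
  have h₁ := s.isState.upperEnvelope_le hΘx le_rfl
  have h₂ := s.isState.upperEnvelope_le (s.functions.neg_mem hΘx) le_rfl
  rw [map_neg] at h₂
  linarith

end Order

variable {X : Type*} [NormedAddCommGroup X] [NormedSpace ℝ X]

theorem exists_squeeze {P : Type*} [TopologicalSpace P] [CompactSpace P] {Θ : X →L[ℝ] C(P, ℝ)}
    {s : SeparatedState Θ} (hs : IsMax s) (x : X) {δ : ℝ} (hδ : 0 < δ) :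
    ∃ h ∈ s.functions, ∃ h' ∈ s.functions, Θ x ≤ h ∧ h' ≤ Θ x ∧ s.state h - s.state h' < δ := by
  by_contra! hgap
  have h1 := s.one_mem_functions
  have hle : δ ≤ upperEnvelope s.state s.functions (Θ x) +
      upperEnvelope s.state s.functions (-Θ x) := by
    rw [← sub_le_iff_le_add]
    refine le_upperEnvelope h1 fun h hh hxh => ?_
    rw [sub_le_comm]
    refine le_upperEnvelope h1 fun h' hh' hxh' => ?_
    have := hgap h hh (-h') (s.functions.neg_mem hh') hxh (neg_le.1 hxh')
    rw [map_neg] at this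
    linarith
  have hlt := upperEnvelope_add_upperEnvelope_neg_lt_two hs ((2 / δ) • x)
  rw [map_smul, ← smul_neg, s.isState.upperEnvelope_smul h1 (by positivity),
    s.isState.upperEnvelope_smul h1 (by positivity), ← mul_add, div_mul_eq_mul_div,
    div_lt_iff₀ hδ] at hlt
  linarith

end SeparatedState

theorem countable_of_isSeparable_image {α Y : Type*} [PseudoMetricSpace Y] {f : α → Y} {s : Set α}
    {ε : ℝ} (hε : 0 < ε) (hf : ∀ x ∈ s, ∀ y ∈ s, x ≠ y → ε ≤ dist (f x) (f y))
    (hs : TopologicalSpace.IsSeparable (f '' s)) : s.Countable := by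
  have : DiscreteTopology (f '' s) := .of_forall_le_dist hε <| by
    rintro ⟨-, x, hx, rfl⟩ ⟨-, y, hy, rfl⟩ hxy
    exact hf x hx y hy (ne_of_apply_ne (fun z => (f z)) (Subtype.coe_ne_coe.2 hxy))
  have hinj : InjOn f s := fun x hx y hy hxy => by
    by_contra hne
    have := hf x hx y hy hne
    rw [hxy, dist_self] at this
    exact hε.not_ge this
  exact countable_of_injective_of_countable_image hinj
    (TopologicalSpace.separableSpace_iff_countable.1 hs.separableSpace)

theorem SeparatedState.hasAnnihilatingFamily {X : Type*} [NormedAddCommGroup X] [NormedSpace ℝ X]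
    {P : Type*} [TopologicalSpace P] [CompactSpace P] {Θ : X →L[ℝ] C(P, ℝ)}
    (s : SeparatedState Θ) (hs : ¬ s.carrier.Countable) : HasAnnihilatingFamily X := by
  obtain ⟨H, _, _, _, T, hT⟩ := s.isState.exists_hilbert
  refine .of_not_isSeparable_range (T ∘L Θ) fun hsep => hs ?_
  refine countable_of_isSeparable_image (f := T ∘L Θ) one_pos (fun x hx y hy hxy => ?_)
    (hsep.mono (image_subset_range (T ∘L Θ) s.carrier))
  have : 1 ≤ ‖T (Θ x - Θ y)‖ ^ 2 := by
    rw [← real_inner_self_eq_norm_sq, hT, ← sq]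
    exact s.one_le x hx y hy hxy
  rw [dist_eq_norm, ← map_sub, ContinuousLinearMap.comp_apply, map_sub]
  exact one_le_sq_iff₀ (norm_nonneg _) |>.1 this

section SmallFibers

variable {X P : Type*} [NormedAddCommGroup X] [NormedSpace ℝ X] [TopologicalSpace P]
  {Θ : X →L[ℝ] C(P, ℝ)}

theorem exists_finset_one_lt_abs_sub (hΘ : Function.Injective fun (p : P) (x : X) => Θ x p)
    {D : Set (P × P)} (hD : IsCompact D) (hne : ∀ q ∈ D, q.1 ≠ q.2) :
    ∃ R : Finset X, ∀ q ∈ D, ∃ x ∈ R, 1 < |Θ x q.1 - Θ x q.2| := by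
  obtain ⟨R, hR⟩ := hD.elim_finite_subcover (fun x : X => {q | 1 < |Θ x q.1 - Θ x q.2|})
    (fun x => isOpen_lt continuous_const (by fun_prop)) fun q hq => by
      obtain ⟨x, hx⟩ := Function.ne_iff.1 (hΘ.ne (hne q hq))
      have hpos : 0 < |Θ x q.1 - Θ x q.2| := abs_pos.2 (sub_ne_zero.2 hx)
      refine mem_iUnion.2 ⟨(2 / |Θ x q.1 - Θ x q.2|) • x, ?_⟩
      rw [mem_ofPred_eq, map_smul, ContinuousMap.smul_apply, ContinuousMap.smul_apply, ← smul_sub,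
        smul_eq_mul, abs_mul, abs_of_pos (div_pos two_pos hpos), div_mul_cancel₀ _ hpos.ne']
      exact one_lt_two
  exact ⟨R, fun q hq => by simpa using hR hq⟩

variable [CompactSpace P]

theorem exists_finset_forall_one_lt_abs_sub [T2Space P]
    (hΘ : Function.Injective fun (p : P) (x : X) => Θ x p) {F : P → Set P}
    (hF : ∀ p, ∃ U ∈ 𝓝 p, ∀ q, ¬ F q ⊆ U) :
    ∃ R : Finset X, ∀ q, ∃ r ∈ F q, ∃ x ∈ R, 1 < |Θ x q - Θ x r| := by
  choose U hU hFU using hF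
  choose W hW hWc hWU using fun p =>
    exists_mem_nhds_isClosed_subset (interior_mem_nhds.2 (hU p))
  obtain ⟨I, hI⟩ := isCompact_univ.elim_nhds_subcover W fun p _ => hW p
  have hD : IsCompact (⋃ p ∈ I, W p ×ˢ (interior (U p))ᶜ) := I.isCompact_biUnion fun p _ =>
    (hWc p).isCompact.prod isOpen_interior.isClosed_compl.isCompact
  obtain ⟨R, hR⟩ := exists_finset_one_lt_abs_sub hΘ hD fun ⟨q, r⟩ hqr => by
    obtain ⟨p, -, hq, hr⟩ := mem_iUnion₂.1 hqr
    exact fun hqr' : q = r => hr (hWU p (hqr' ▸ hq))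
  refine ⟨R, fun q => ?_⟩
  obtain ⟨p, hp, hq⟩ := mem_iUnion₂.1 (hI.2 (mem_univ q))
  obtain ⟨r, hr, hrU⟩ := not_subset.1 (hFU p q)
  exact ⟨r, hr, hR (q, r) (mem_iUnion₂.2 ⟨p, hp, hq, fun h => hrU (interior_subset h)⟩)⟩

namespace SeparatedState

variable {s : SeparatedState Θ}

theorem exists_forall_abs_sub_le_one (hs : IsMax s) (R : Finset X) :
    ∃ q, ∀ r ∈ jointFiber Θ s.carrier q, ∀ x ∈ R, |Θ x q - Θ x r| ≤ 1 := by
  by_contra! hosc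
  have hδ : (0 : ℝ) < 1 / (R.card + 1) := Nat.one_div_pos_of_nat
  choose h hh h' hh' hle hle' hlt using fun x => exists_squeeze hs x hδ
  have hsum : 1 ≤ ∑ x ∈ R, (h x - h' x) := fun q => by
    obtain ⟨r, hr, x, hx, hxr⟩ := hosc q
    have hxle : 1 ≤ (h x - h' x) q := by
      have hq : Θ x q ∈ Icc (h' x q) (h x q) := ⟨hle' x q, hle x q⟩
      have hr : Θ x r ∈ Icc (h' x q) (h x q) := by
        rw [← hh x q r hr, ← hh' x q r hr]
        exact ⟨hle' x r, hle x r⟩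
      exact hxr.le.trans (Real.dist_le_of_mem_Icc hq hr)
    change 1 ≤ (∑ x ∈ R, (h x - h' x)) q
    rw [ContinuousMap.sum_apply]
    exact hxle.trans (Finset.single_le_sum (f := fun x => (h x - h' x) q)
      (fun y _ => sub_nonneg.2 ((hle' y q).trans (hle y q))) hx)
  have hone := s.isState.mono hsum
  rw [s.isState.map_one, map_sum] at hone
  have hcard : ∑ x ∈ R, s.state (h x - h' x) ≤ R.card • (1 / (R.card + 1 : ℝ)) :=
    Finset.sum_le_card_nsmul _ _ _ fun x _ => by
      rw [map_sub]
      exact (hlt x).le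
  rw [nsmul_eq_mul, mul_one_div] at hcard
  have : (R.card : ℝ) / (R.card + 1) < 1 := by
    rw [div_lt_one (by positivity)]
    exact lt_add_one _
  linarith

theorem exists_jointFiber_subset [T2Space P]
    (hΘ : Function.Injective fun (p : P) (x : X) => Θ x p) (hs : IsMax s) :
    ∃ p, ∀ U ∈ 𝓝 p, ∃ q, jointFiber Θ s.carrier q ⊆ U := by
  by_contra! hno
  obtain ⟨R, hR⟩ := exists_finset_forall_one_lt_abs_sub hΘ hno
  obtain ⟨q, hq⟩ := exists_forall_abs_sub_le_one hs R
  obtain ⟨r, hr, x, hx, hlt⟩ := hR q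
  exact (hq r hr x hx).not_gt hlt

end SeparatedState

theorem hasAnnihilatingFamily_or_exists_jointFiber_subset [T2Space P] [Nonempty P]
    (hΘ : Function.Injective fun (p : P) (x : X) => Θ x p) :
    HasAnnihilatingFamily X ∨
      ∃ E : Set X, E.Countable ∧ ∃ p, ∀ U ∈ 𝓝 p, ∃ q, jointFiber Θ E q ⊆ U := by
  obtain ⟨s, hs⟩ := SeparatedState.exists_isMax Θ
  by_cases hc : s.carrier.Countable
  · exact .inr ⟨s.carrier, hc, SeparatedState.exists_jointFiber_subset hΘ hs⟩
  · exact .inl (s.hasAnnihilatingFamily hc)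

end SmallFibers

/-- A set containing the closure of each of its countable subsets. A space is countably tight if and
only if all these sets are closed. -/
def IsOmegaClosed {K : Type*} [TopologicalSpace K] (A : Set K) : Prop :=
  ∀ C ⊆ A, C.Countable → closure C ⊆ A

section OmegaClosed

variable {K : Type*} [TopologicalSpace K] {A : Set K}

theorem isOmegaClosed_iUnion_of_monotone {F : OmegaOne → Set K} (hF : Monotone F)
    (hFc : ∀ i, IsClosed (F i)) : IsOmegaClosed (⋃ i, F i) := fun C hCF hC => by
  choose! k hk using fun c (hc : c ∈ C) => mem_iUnion.1 (hCF hc)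
  obtain ⟨i, hi⟩ := exists_forall_lt_of_countable (hC.image k)
  exact (closure_minimal (fun c hc => hF (hi _ (mem_image_of_mem k hc)).le (hk c hc))
    (hFc i)).trans (subset_iUnion F i)

theorem isOmegaClosed_countableClosure (A : Set K) :
    IsOmegaClosed {x | ∃ B ⊆ A, B.Countable ∧ x ∈ closure B} := fun C hCA hC x hx => by
  choose! B hBA hB hcB using fun c (hc : c ∈ C) => hCA hc
  exact ⟨⋃ c ∈ C, B c, iUnion₂_subset hBA, hC.biUnion hB, closure_minimal
    (fun c hc => closure_mono (subset_biUnion_of_mem (u := B) hc) (hcB c hc)) isClosed_closure hx⟩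

theorem exists_isOmegaClosed_not_isClosed (hK : ¬ IsCountablyTight K) :
    ∃ A : Set K, IsOmegaClosed A ∧ ¬ IsClosed A := by
  simp only [IsCountablyTight, not_forall] at hK
  obtain ⟨A, z, hz, hB⟩ := hK
  refine ⟨_, isOmegaClosed_countableClosure A, fun hcl =>
    hB (closure_minimal (fun a ha => ?_) hcl hz)⟩
  exact ⟨{a}, singleton_subset_iff.2 ha, countable_singleton a, subset_closure (mem_singleton a)⟩

variable [CompactSpace K]

theorem IsOmegaClosed.isClosed_image {Y : Type*} [TopologicalSpace Y] [T2Space Y]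
    [FrechetUrysohnSpace Y] {π : K → Y} (hA : IsOmegaClosed A) (hπ : Continuous π) :
    IsClosed (π '' A) := isClosed_of_closure_subset fun y hy => by
  obtain ⟨u, hu, hlim⟩ := mem_closure_iff_seq_limit.1 hy
  choose a ha hau using hu
  have hcl : IsClosed (π '' closure (range a)) := (isClosed_closure.isCompact.image hπ).isClosed
  have hmem (n : ℕ) : u n ∈ π '' closure (range a) :=
    ⟨a n, subset_closure (mem_range_self n), hau n⟩
  exact image_mono (hA _ (range_subset_iff.2 ha) (countable_range a))
    (hcl.mem_of_tendsto hlim (.of_forall hmem))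

end OmegaClosed

section JointFiber

variable {ι K : Type*} [TopologicalSpace K] {Θ : ι → C(K, ℝ)} {E E' : Set ι} {A : Set K} {p q : K}

theorem isClosed_jointFiber : IsClosed (jointFiber Θ E q) := by
  simp only [jointFiber, ofPred_forall]
  exact isClosed_biInter fun x _ => isClosed_eq (by fun_prop) continuous_const

theorem jointFiber_anti (h : E ⊆ E') : jointFiber Θ E' q ⊆ jointFiber Θ E q :=
  fun _ hr x hx => hr x (h hx)

theorem mem_jointFiber_trans {r : K} (hr : r ∈ jointFiber Θ E p) (hp : p ∈ jointFiber Θ E q) :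
    r ∈ jointFiber Θ E q :=
  fun x hx => (hr x hx).trans (hp x hx)

theorem IsOmegaClosed.exists_mem_jointFiber [CompactSpace K] (hA : IsOmegaClosed A)
    (hp : p ∈ closure A) (hE : E.Countable) : ∃ a ∈ A, a ∈ jointFiber Θ E p := by
  have := hE.to_subtype
  have hπ : Continuous fun (r : K) (x : E) => Θ x r := by fun_prop
  obtain ⟨a, ha, hap⟩ := closure_minimal subset_rfl (hA.isClosed_image hπ)
    (image_closure_subset_closure_image hπ (mem_image_of_mem _ hp))
  exact ⟨a, ha, fun x hx => congrFun hap ⟨x, hx⟩⟩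

end JointFiber

section FreeSequence

variable {X K : Type*} [NormedAddCommGroup X] [NormedSpace ℝ X] [TopologicalSpace K]
  [CompactSpace K] {Θ : X →L[ℝ] C(K, ℝ)} {A : Set K} {z : K}

theorem exists_finite_disjoint_jointFiber (hΘ : Function.Injective fun (p : K) (x : X) => Θ x p)
    (hA : IsClosed A) (hz : z ∉ A) : ∃ R : Finset X, Disjoint A (jointFiber Θ R z) := by
  obtain ⟨R, hR⟩ := exists_finset_one_lt_abs_sub hΘ (hA.isCompact.prod isCompact_singleton)
    fun (q : K × K) (hq : q ∈ A ×ˢ {z}) => fun h => hz (hq.2 ▸ h ▸ hq.1)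
  refine ⟨R, disjoint_left.2 fun q hq hqz => ?_⟩
  obtain ⟨x, hx, hlt⟩ := hR (q, z) ⟨hq, rfl⟩
  rw [hqz x hx, sub_self, abs_zero] at hlt
  exact hlt.not_gt one_pos

theorem IsOmegaClosed.exists_freeSequence (hΘ : Function.Injective fun (p : K) (x : X) => Θ x p)
    (hA : IsOmegaClosed A) (hz : z ∈ closure A) (hzA : z ∉ A) :
    ∃ (a : OmegaOne → K) (T : OmegaOne → Set X), (∀ i, (T i).Countable) ∧ Monotone T ∧
      (∀ i, a i ∈ jointFiber Θ (T i) z) ∧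
      ∀ i, Disjoint (closure (a '' Iio i)) (jointFiber Θ (T i) z) := by
  let Y := A × {T : Set X // T.Countable}
  let pt : Y → K := fun y => y.1
  obtain ⟨f, hf⟩ := exists_omegaOne_seq (R := fun (C : Set Y) y => (∀ c ∈ C, c.2.1 ⊆ y.2.1) ∧
      pt y ∈ jointFiber Θ y.2.1 z ∧ Disjoint (closure (pt '' C)) (jointFiber Θ y.2.1 z))
    fun C hC => by
    have hCA : closure (pt '' C) ⊆ A := hA _ (image_subset_iff.2 fun c _ => c.1.2) (hC.image _)
    obtain ⟨R, hR⟩ := exists_finite_disjoint_jointFiber hΘ isClosed_closure fun h => hzA (hCA h)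
    have hT : (↑R ∪ ⋃ c ∈ C, c.2.1).Countable :=
      R.countable_toSet.union (hC.biUnion fun c _ => c.2.2)
    obtain ⟨a, ha, haz⟩ := hA.exists_mem_jointFiber (Θ := Θ) hz hT
    exact ⟨(⟨a, ha⟩, ⟨_, hT⟩), fun c hc => (subset_biUnion_of_mem (u := fun c : Y => c.2.1)
      hc).trans subset_union_right, haz, hR.mono_right (jointFiber_anti subset_union_left)⟩
  refine ⟨fun i => pt (f i), fun i => (f i).2.1, fun i => (f i).2.2, fun i j hij => ?_,
    fun i => (hf i).2.1, fun i => by simpa only [image_image] using (hf i).2.2⟩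
  rcases hij.eq_or_lt with rfl | hij
  · exact Subset.rfl
  · exact (hf j).1 _ (mem_image_of_mem f hij)

/-- The free sequence above, with all its limits at stages before `ω₁`, gives `D`; its limits at
stage `ω₁` are separated from `D` by the fibres `jointFiber Θ (T i) z`. -/
theorem IsOmegaClosed.exists_disjoint_iInter_jointFiber
    (hΘ : Function.Injective fun (p : K) (x : X) => Θ x p) (hA : IsOmegaClosed A)
    (hA' : ¬ IsClosed A) :
    ∃ (D : Set K) (z : K) (T : OmegaOne → Set X), IsOmegaClosed D ∧ (∀ i, (T i).Countable) ∧
      Monotone T ∧ (closure D ∩ ⋂ i, jointFiber Θ (T i) z).Nonempty ∧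
      Disjoint D (⋂ i, jointFiber Θ (T i) z) := by
  obtain ⟨z, hz, hzA⟩ := not_subset.1 (mt isClosed_of_closure_subset hA')
  obtain ⟨a, T, hTc, hT, haT, hfree⟩ := hA.exists_freeSequence hΘ hz hzA
  refine ⟨⋃ i, closure (a '' Iio i), z, T, isOmegaClosed_iUnion_of_monotone (fun i j hij =>
    closure_mono (image_mono (Iio_subset_Iio hij))) fun _ => isClosed_closure, hTc, hT, ?_,
    disjoint_iUnion_left.2 fun i => (hfree i).mono_right (iInter_subset _ i)⟩
  obtain ⟨q, hq⟩ := exists_clusterPt_of_compactSpace (map a atTop)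
  refine ⟨q, isClosed_closure.mem_of_mapClusterPt hq (.of_forall fun j => subset_closure ?_),
    mem_iInter.2 fun i => isClosed_jointFiber.mem_of_mapClusterPt hq ?_⟩
  · obtain ⟨i, hi⟩ := exists_gt j
    exact mem_iUnion.2 ⟨i, subset_closure (mem_image_of_mem a hi)⟩
  · filter_upwards [eventually_ge_atTop i] with j hij
    exact jointFiber_anti (hT hij) (haT j)

end FreeSequence

theorem exists_seq_jointFiber_subset {ι P : Type*} [TopologicalSpace P] [CompactSpace P]
    {Θ : ι → C(P, ℝ)} {E : Set ι} (hE : E.Countable) {p : P}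
    (hp : ∀ U ∈ 𝓝 p, ∃ q, jointFiber Θ E q ⊆ U) :
    ∃ c : ℕ → P, ∀ U ∈ 𝓝 p, ∃ n, jointFiber Θ E (c n) ⊆ U := by
  have : Countable E := hE.to_subtype
  have : Nonempty P := ⟨p⟩
  let π : P → E → ℝ := fun r x => Θ x r
  have hπ : Continuous π := by fun_prop
  obtain ⟨y, hy⟩ := TopologicalSpace.exists_dense_seq (range π)
  choose c hc using fun n => (y n).2
  refine ⟨c, fun U hU => ?_⟩
  obtain ⟨V, hVU, hV, hpV⟩ := mem_nhds_iff.1 hU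
  obtain ⟨q, hq⟩ := hp V (hV.mem_nhds hpV)
  have hcl : IsClosed (π '' Vᶜ) := (hV.isClosed_compl.isCompact.image hπ).isClosed
  have hqV : π q ∉ π '' Vᶜ := fun ⟨r, hr, hrq⟩ => hr (hq fun x hx => congrFun hrq ⟨x, hx⟩)
  obtain ⟨-, hn, n, rfl⟩ := hy.inter_open_nonempty _
    (hcl.isOpen_compl.preimage continuous_subtype_val) ⟨⟨π q, mem_range_self q⟩, hqV⟩
  refine ⟨n, fun r hr => hVU (by_contra fun hrV => hn ⟨r, hrV, ?_⟩)⟩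
  rw [← hc n]
  exact funext fun x => hr x x.2

section ConvergentSequence

variable {X K : Type*} [NormedAddCommGroup X] [NormedSpace ℝ X] [TopologicalSpace K]
  [CompactSpace K]

theorem hasAnnihilatingFamily_or_exists_seq_inter_jointFiber_subset [T2Space K]
    {Θ : X →L[ℝ] C(K, ℝ)} (hΘ : Function.Injective fun (p : K) (x : X) => Θ x p)
    {P : Set K} (hP : IsClosed P) (hne : P.Nonempty) :
    HasAnnihilatingFamily X ∨ ∃ E : Set X, E.Countable ∧ ∃ p ∈ P, ∃ c : ℕ → K, (∀ n, c n ∈ P) ∧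
      ∀ U ∈ 𝓝 p, ∃ n, P ∩ jointFiber Θ E (c n) ⊆ U := by
  have : CompactSpace P := isCompact_iff_compactSpace.1 hP.isCompact
  have : Nonempty P := hne.to_subtype
  let ρ : C(K, ℝ) →L[ℝ] C(P, ℝ) :=
    ⟨(ContinuousMap.compRightAlgHom ℝ ℝ ⟨Subtype.val, continuous_subtype_val⟩).toLinearMap,
      ContinuousMap.compRightAlgHom_continuous _ _ _⟩
  refine (hasAnnihilatingFamily_or_exists_jointFiber_subset (Θ := ρ ∘L Θ)
    (hΘ.comp Subtype.val_injective)).imp_right fun ⟨E, hE, p, hp⟩ => ?_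
  obtain ⟨c, hc⟩ := exists_seq_jointFiber_subset hE hp
  refine ⟨E, hE, p, p.2, fun n => c n, fun n => (c n).2, fun U hU => ?_⟩
  obtain ⟨n, hn⟩ := hc _ (continuousAt_subtype_val.preimage_mem_nhds hU)
  exact ⟨n, fun r hr => @hn ⟨r, hr.1⟩ hr.2⟩

variable {ι : Type*} {Θ : ι → C(K, ℝ)} {D : Set K} {z p : K} {T : OmegaOne → Set ι} {E : Set ι}

theorem eventually_mem_of_inter_jointFiber_subset (hT : Monotone T) {c : K}
    (hc : ∀ i, c ∈ jointFiber Θ (T i) z) {b : OmegaOne → K} (hbD : ∀ i, b i ∈ D)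
    (hb : ∀ i, b i ∈ jointFiber Θ (E ∪ T i) c) {V : Set K} (hV : IsOpen V)
    (hcV : (closure D ∩ ⋂ i, jointFiber Θ (T i) z) ∩ jointFiber Θ E c ⊆ V) :
    ∀ᶠ i in atTop, b i ∈ V := by
  let F : OmegaOne → Set K := fun i => closure D ∩ jointFiber Θ (E ∪ T i) c
  have hF : Antitone F := fun i j hij =>
    inter_subset_inter_right _ (jointFiber_anti (union_subset_union_right E (hT hij)))
  obtain ⟨i, hi⟩ := exists_subset_nhds_of_compactSpace hF.directed_ge
    (fun i => isClosed_closure.inter isClosed_jointFiber) (U := V) fun r hr => by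
      rw [mem_iInter] at hr
      refine hV.mem_nhds (hcV ⟨⟨(hr (Classical.arbitrary _)).1, mem_iInter.2 fun i => ?_⟩, ?_⟩)
      · exact mem_jointFiber_trans (jointFiber_anti subset_union_right (hr i).2) (hc i)
      · exact jointFiber_anti subset_union_left (hr (Classical.arbitrary _)).2
  filter_upwards [eventually_ge_atTop i] with j hij
  exact hi (hF hij ⟨subset_closure (hbD j), hb j⟩)

theorem IsOmegaClosed.exists_tendsto [T2Space K] (hD : IsOmegaClosed D)
    (hTc : ∀ i, (T i).Countable) (hT : Monotone T) (hE : E.Countable) {c : ℕ → K}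
    (hc : ∀ n, c n ∈ closure D ∩ ⋂ i, jointFiber Θ (T i) z)
    (hp : ∀ U ∈ 𝓝 p, ∃ n, (closure D ∩ ⋂ i, jointFiber Θ (T i) z) ∩ jointFiber Θ E (c n) ⊆ U) :
    ∃ a : OmegaOne → K, (∀ i, a i ∈ D) ∧ Tendsto a atTop (𝓝 p) := by
  let fib : ℕ → Set K := fun n =>
    (closure D ∩ ⋂ i, jointFiber Θ (T i) z) ∩ jointFiber Θ E (c n)
  have : (comap fib (𝓝 p).smallSets).NeBot := comap_neBot fun t ht => by
    obtain ⟨U, hU, hUt⟩ := (hasBasis_smallSets _).mem_iff.1 ht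
    exact (hp U hU).imp fun n hn => hUt hn
  let 𝓤 : Ultrafilter ℕ := .of (comap fib (𝓝 p).smallSets)
  have h𝓤 : Tendsto fib 𝓤 (𝓝 p).smallSets := tendsto_comap.mono_left (Ultrafilter.of_le _)
  choose b hbD hb using fun (n : ℕ) (i : OmegaOne) =>
    hD.exists_mem_jointFiber (Θ := Θ) (hc n).1 (hE.union (hTc i))
  let a : OmegaOne → K := fun i => (𝓤.map fun n => b n i).lim
  have hlim (i : OmegaOne) : Tendsto (fun n => b n i) 𝓤 (𝓝 (a i)) :=
    (𝓤.map fun n => b n i).le_nhds_lim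
  refine ⟨a, fun i => hD (range fun n => b n i) (range_subset_iff.2 fun n => hbD n i)
    (countable_range _) (mem_closure_of_tendsto (hlim i) (.of_forall mem_range_self)), ?_⟩
  refine (closed_nhds_basis p).tendsto_right_iff.2 fun W ⟨hW, hWc⟩ => ?_
  have hev : ∀ᶠ i in atTop, ∀ n, fib n ⊆ interior W → b n i ∈ interior W := by
    refine eventually_countable_forall.2 fun n => ?_
    by_cases hn : fib n ⊆ interior W
    · exact (eventually_mem_of_inter_jointFiber_subset hT (mem_iInter.1 (hc n).2) (hbD n) (hb n)
        isOpen_interior hn).mono fun i hi _ => hi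
    · exact .of_forall fun i h => absurd h hn
  filter_upwards [hev] with i hi
  refine hWc.mem_of_tendsto (hlim i) ?_
  filter_upwards [tendsto_smallSets_iff.1 h𝓤 _ (interior_mem_nhds.2 hW)] with n hn
  exact interior_subset (hi n hn)

theorem HasAnnihilatingFamily.of_not_isCountablyTight [T2Space K] {Θ : X →L[ℝ] C(K, ℝ)}
    (hΘ : Function.Injective fun (p : K) (x : X) => Θ x p) (hK : ¬ IsCountablyTight K) :
    HasAnnihilatingFamily X := by
  obtain ⟨A, hA, hA'⟩ := exists_isOmegaClosed_not_isClosed hK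
  obtain ⟨D, z, T, hD, hTc, hT, hne, hdisj⟩ := hA.exists_disjoint_iInter_jointFiber hΘ hA'
  refine (hasAnnihilatingFamily_or_exists_seq_inter_jointFiber_subset hΘ
    (isClosed_closure.inter (isClosed_iInter fun _ => isClosed_jointFiber)) hne).elim id ?_
  rintro ⟨E, hE, p, hpP, c, hc, hp⟩
  obtain ⟨a, haD, hap⟩ := hD.exists_tendsto hTc hT hE hc hp
  exact .of_tendsto hΘ hap fun i hi => disjoint_left.1 hdisj (haD i) (hi ▸ hpP.2)

end ConvergentSequence

section DualBall

theorem exists_strongDual_lp_one_single_eq {ι : Type*} [DecidableEq ι] {a : ι → ℝ}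
    (ha : ∀ i, |a i| ≤ 1) : ∃ σ : StrongDual ℝ (lp (fun _ : ι => ℝ) 1),
      ‖σ‖ ≤ 1 ∧ ∀ i, σ (lp.single 1 i 1) = a i := by
  let B : ι → ℝ →L[ℝ] ℝ := fun i => a i • .id ℝ ℝ
  have hB (i : ι) : ‖B i‖ ≤ 1 := by simpa [B, norm_smul] using ha i
  refine ⟨lp.tsumCLM ℝ ι ℝ ∘L lp.mapCLM 1 B zero_le_one hB, ?_, fun i => ?_⟩
  · exact (ContinuousLinearMap.opNorm_comp_le _ _).trans
      (mul_le_one₀ lp.norm_tsumCLM_le (norm_nonneg _) (lp.norm_mapCLM_le 1 B zero_le_one hB))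
  · change ∑' j, a j * (lp.single 1 i (1 : ℝ) : lp (fun _ : ι => ℝ) 1) j = a i
    rw [tsum_eq_single i fun j hj => by simp [lp.single_apply, hj]]
    simp

variable {X : Type*} [NormedAddCommGroup X] [NormedSpace ℝ X]

theorem exists_weakStarDualBall_single_eq {ι : Type*} [DecidableEq ι] {Y : Submodule ℝ X}
    (T : lp (fun _ : ι => ℝ) 1 ≃L[ℝ] Y) : ∃ c > 0, ∀ a : ι → ℝ, (∀ i, |a i| ≤ 1) →
      ∃ f : weakStarDualBall X, ∀ i, f.1 (T (lp.single 1 i 1)) = c * a i := by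
  let S : Y →L[ℝ] lp (fun _ : ι => ℝ) 1 := T.symm
  have hS : 0 < ‖S‖ + 1 := by positivity
  refine ⟨(‖S‖ + 1)⁻¹, inv_pos.2 hS, fun a ha => ?_⟩
  obtain ⟨σ, hσ, hσa⟩ := exists_strongDual_lp_one_single_eq ha
  obtain ⟨g, hg, hgn⟩ := exists_extension_norm_eq Y ((‖S‖ + 1)⁻¹ • σ ∘L S)
  have hg1 : ‖g‖ ≤ 1 := calc
    ‖g‖ ≤ (‖S‖ + 1)⁻¹ * (‖σ‖ * ‖S‖) := by
      rw [hgn]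
      refine (ContinuousLinearMap.opNorm_smul_le _ _).trans ?_
      rw [Real.norm_of_nonneg (inv_nonneg.2 hS.le)]
      gcongr
      exact ContinuousLinearMap.opNorm_comp_le σ S
    _ ≤ (‖S‖ + 1)⁻¹ * (‖S‖ + 1) := by
      gcongr
      exact (mul_le_of_le_one_left (norm_nonneg S) hσ).trans (le_add_of_nonneg_right zero_le_one)
    _ = 1 := inv_mul_cancel₀ hS.ne'
  refine ⟨⟨StrongDual.toWeakDual g, hg1⟩, fun i => (hg _).trans ?_⟩
  change (‖S‖ + 1)⁻¹ * σ (T.symm (T (lp.single 1 i 1))) = _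
  rw [T.symm_apply_apply, hσa]

theorem not_isCountablyTight_of_forall_indicator {K : Type*} [TopologicalSpace K] [CompactSpace K]
    {g : OmegaOne → C(K, ℝ)} {c : ℝ} (hc : c ≠ 0)
    (hg : ∀ C : Set OmegaOne, ∃ p, ∀ i, g i p = C.indicator (fun _ => c) i) :
    ¬ IsCountablyTight K := by
  choose f hf using hg
  obtain ⟨z, hz⟩ : ∃ z, MapClusterPt z atTop fun i => f (Iio i) :=
    exists_clusterPt_of_compactSpace _
  have hgz (i : OmegaOne) : g i z = c := by
    have hcl : IsClosed {p | g i p = c} := isClosed_eq (g i).continuous continuous_const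
    refine hcl.mem_of_mapClusterPt hz ?_
    filter_upwards [eventually_gt_atTop i] with j hij
    exact (hf (Iio j) i).trans (indicator_of_mem (mem_Iio.2 hij) _)
  have hzA : z ∈ closure (f '' {C | C.Countable}) :=
    isClosed_closure.mem_of_mapClusterPt hz (.of_forall fun i =>
      subset_closure (mem_image_of_mem f (countable_Iio_omegaOne i)))
  intro ht
  obtain ⟨B, hBA, hB, hzB⟩ := ht _ z hzA
  choose! C hC hCB using fun p (hp : p ∈ B) => hBA hp
  obtain ⟨i, hi⟩ := exists_forall_lt_of_countable (hB.biUnion hC)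
  have hcl : closure B ⊆ {p | g i p = 0} := by
    refine closure_minimal (fun p hp => ?_) (isClosed_eq (g i).continuous continuous_const)
    have hiC : i ∉ C p := fun h => (hi i (mem_biUnion hp h)).false
    exact (congrArg (g i) (hCB p hp)).symm.trans ((hf _ i).trans (indicator_of_notMem hiC _))
  exact hc ((hgz i).symm.trans (hcl hzB))

instance compactSpace_weakStarDualBall : CompactSpace (weakStarDualBall X) := by
  have : weakStarDualBall X = WeakDual.toStrongDual ⁻¹' Metric.closedBall 0 1 := by
    ext f
    simp [weakStarDualBall]
  rw [← isCompact_iff_compactSpace, this]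
  exact WeakDual.isCompact_closedBall 0 1

/-- The canonical embedding of `X` into the continuous functions on its weak* dual ball. -/
noncomputable def dualBallEval : X →L[ℝ] C(weakStarDualBall X, ℝ) :=
  LinearMap.mkContinuous
    { toFun := fun x => ⟨fun f => f.1 x, (WeakDual.eval_continuous x).comp continuous_subtype_val⟩
      map_add' := fun x y => ContinuousMap.ext fun f => map_add f.1 x y
      map_smul' := fun r x => ContinuousMap.ext fun f => map_smul f.1 r x }
    1 fun x => (ContinuousMap.norm_le _ (by positivity)).2 fun f =>
      (WeakDual.toStrongDual f.1).le_of_opNorm_le f.2 x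

theorem injective_dualBallEval :
    Function.Injective fun (f : weakStarDualBall X) (x : X) => dualBallEval x f :=
  fun _ _ hfg => Subtype.ext (DFunLike.ext _ _ (congrFun hfg))

theorem ContainsEllOneOmegaOne.not_isCountablyTight (h : ContainsEllOneOmegaOne X) :
    ¬ IsCountablyTight (weakStarDualBall X) := by
  classical
  obtain ⟨Y, ⟨T⟩⟩ := h
  obtain ⟨c, hc, hT⟩ := exists_weakStarDualBall_single_eq T
  refine not_isCountablyTight_of_forall_indicator
    (g := fun i : OmegaOne => dualBallEval (T (lp.single 1 i 1) : X)) hc.ne' fun C => ?_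
  obtain ⟨f, hf⟩ := hT (C.indicator 1) fun i => by by_cases hi : i ∈ C <;> simp [hi]
  refine ⟨f, fun i => (hf i).trans ?_⟩
  by_cases hi : i ∈ C <;> simp [hi]

end DualBall

theorem theorem1p5 (X : Type u) [NormedAddCommGroup X] [NormedSpace ℝ X] [CompleteSpace X]
    (hX : ¬ TopologicalSpace.SeparableSpace X)
    (h : HasFundamentalBiorthogonalSystem X ∨
      IsSpaceOfContinuousOnScattered.{u, v} X ∨
      ContainsEllOneOmegaOne X ∨
      ¬ IsCountablyTight (weakStarDualBall X)) :
    (∃ F : Set (Submodule ℝ X), (∀ H ∈ F, IsHyperplane H) ∧ #F = ℵ₁ ∧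
      ⋃ H ∈ F, (H : Set X) = Set.univ) ∧
    covNumber X = ℵ₁ := by
  have hA : HasAnnihilatingFamily X := by
    rcases h with h | h | h | h
    · exact .of_hasFundamentalBiorthogonalSystem hX h
    · exact .of_isSpaceOfContinuousOnScattered hX h
    · exact .of_not_isCountablyTight injective_dualBallEval h.not_isCountablyTight
    · exact .of_not_isCountablyTight injective_dualBallEval h
  exact ⟨hA.exists_isHyperplane_cover, hA.covNumber_eq⟩
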